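/- Let $k$ be a perfect field with the discrete topology. A *pseudocompact* $k$-algebra is an associative unital Hausdorff topological $k$-algebra $A$ having a basis of neighbourhoods of $0$ consisting of open two-sided ideals $I$ of finite codimension, such that $A\cong\varprojlim_I A/I$. Its radical $J(A)$ is the intersection of its maximal open left ideals, and $J^2(A)=J(A)J(A)$. Let $\mathbf{PAlg}$ be the category whose objects are the pseudocompact $k$-algebras $A$ such that $A/J(A)$ is isomorphic to a product of copies of $k$ and $A/J^2(A)$ is finite dimensional, and whose morphisms $A\to B$ are the continuous unital $k$-algebra homomorphisms for which the induced map $A/J(A)\to B/J(B)$ is surjective. For morphisms $\alpha,\beta:A\to B$ of $\mathbf{PAlg}$ write $\alpha\sim_1\beta$ if $(\alpha-\beta)(A)\subseteq J(B)$ and $(\alpha-\beta)(J(A))\subseteq J^2(B)$. This is a congruence; let $\mathbf{PAlg}_1=\mathbf{PAlg}/\!\sim_1$ be the quotient category. **Proposition.** If $\alpha:A\to A$ is a morphism of $\mathbf{PAlg}$ with $\alpha\sim_1\mathrm{id}_A$, then $\alpha$ is an isomorphism in $\mathbf{PAlg}$. Hence the projection functor $\mathbf{PAlg}\to\mathbf{PAlg}_1$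 reflects isomorphisms: if the class of a morphism $\alpha:A\to B$ of $\mathbf{PAlg}$ is an isomorphism in $\mathbf{PAlg}_1$, then $\alpha$ is an isomorphism in $\mathbf{PAlg}$. -/

import Mathlib

open CategoryTheory Topology

universe u v

namespace PAlgebra

section Algebras

/-- The open two-sided ideals of finite codimension of a topological `k`-algebra. -/
structure OpenIdeal (k : Type u) (A : Type v) [Field k] [Ring A] [Algebra k A]
    [TopologicalSpace A] where
  ideal : Ideal A
  isTwoSided : ideal.IsTwoSided
  isOpen : IsOpen (ideal : Set A)
  finiteDimensional : FiniteDimensional k (A ⧸ ideal)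

/-- A pseudocompact algebra over a (discrete) field `k`: a Hausdorff topological `k`-algebra in
which the open two-sided ideals of finite codimension form a basis of neighbourhoods of `0`, and
such that the canonical map from `A` to the inverse limit of the quotients `A ⧸ I` over these ideals
is onto. (The canonical map is injective and a homeomorphism onto its image by the Hausdorff and
basis conditions. As `k` is discrete, continuity of `k × A → A` is continuity of multiplication by
each fixed scalar, which holds in any topological ring that is a `k`-algebra.) -/
structure IsPseudocompact (k : Type u) (A : Type v) [Field k] [Ring A] [Algebra k A]
    [TopologicalSpace A] [IsTopologicalRing A] : Prop where
  t2Space : T2Space A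
  hasBasis : (𝓝 (0 : A)).HasBasis (fun _ : OpenIdeal k A => True) (fun I => (I.ideal : Set A))
  complete : ∀ x : ((I : OpenIdeal k A) → A ⧸ I.ideal),
    (∀ (I I' : OpenIdeal k A) (h : I.ideal ≤ I'.ideal),
      Submodule.factor h (x I) = x I') →
      ∃ a : A, ∀ I : OpenIdeal k A, (Submodule.Quotient.mk a : A ⧸ I.ideal) = x I

/-- The Jacobson radical of a topological algebra: the intersection of the maximal open left
ideals. -/
def J (A : Type v) [Ring A] [TopologicalSpace A] : Ideal A :=
  sInf {M : Ideal A | IsOpen (M : Set A) ∧ M.IsMaximal}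

/-- The square `J² = J J` of the radical. -/
def J2 (A : Type v) [Ring A] [TopologicalSpace A] : Ideal A := J A * J A

instance J_isTwoSided (A : Type v) [Ring A] [TopologicalSpace A] [IsTopologicalRing A] :
    (J A).IsTwoSided where
  mul_mem_of_left := by
    intro x b hx
    refine Submodule.mem_sInf.2 ?_
    rintro (M : Ideal A) ⟨hMo, hM⟩
    let r : A →ₗ[A] A := LinearMap.toSpanSingleton A A b
    let N : Ideal A := Submodule.comap r M
    have hNo : IsOpen (N : Set A) := hMo.preimage (continuous_id.mul continuous_const)
    by_cases hb : b ∈ M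
    · exact M.mul_mem_left x hb
    · have hN : N.IsMaximal := by
        rw [Ideal.isMaximal_iff]
        refine ⟨fun h => hb (by simpa [N, r] using h), ?_⟩
        intro K y hNK hyN hyK
        have hyb : y * b ∉ M := hyN
        obtain ⟨c, hc⟩ : ∃ c : A, c * (y * b) - b ∈ M := by
          have htop : M ⊔ Ideal.span {y * b} = ⊤ := by
            refine hM.out.2 _ (lt_of_le_of_ne le_sup_left fun e => hyb ?_)
            rw [e]
            exact Ideal.mem_sup_right (Ideal.mem_span_singleton_self _)
          have h1 : b ∈ M ⊔ Ideal.span {y * b} := htop ▸ Submodule.mem_top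
          obtain ⟨m, hm, z, hz, hmz⟩ := Submodule.mem_sup.1 h1
          obtain ⟨c, rfl⟩ := Ideal.mem_span_singleton'.1 hz
          refine ⟨c, ?_⟩
          have h5 : c * (y * b) - b = -m := by
            rw [sub_eq_iff_eq_add, eq_neg_add_iff_add_eq]; exact hmz
          rw [h5]
          exact M.neg_mem hm
        have h2 : c * y - 1 ∈ N := by
          simpa [N, r, sub_mul, mul_assoc] using hc
        have h3 := K.sub_mem (K.mul_mem_left c hyK) (hNK h2)
        simpa using h3
      exact (Submodule.mem_sInf.1 hx) N ⟨hNo, hN⟩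

/-- `A` is pointed: `A ⧸ J(A)` is isomorphic to a product of copies of `k`. (When `A ⧸ J(A)` has
finite dimension, as in the category considered below, the product is necessarily finite and no
topology is involved.) -/
def IsPointed (k : Type u) (A : Type v) [Field k] [Ring A] [Algebra k A] [TopologicalSpace A]
    [IsTopologicalRing A] : Prop :=
  ∃ ι : Type v, Nonempty ((A ⧸ J A) ≃ₐ[k] (ι → k))

theorem finiteDimensional_quotient_J (k : Type u) (A : Type v) [Field k] [Ring A] [Algebra k A]
    [TopologicalSpace A] (h : FiniteDimensional k (A ⧸ J2 A)) : FiniteDimensional k (A ⧸ J A) := by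
  have hle : J2 A ≤ J A := Ideal.mul_le_right
  exact Module.Finite.of_surjective ((Submodule.factor hle).restrictScalars k)
    (Submodule.factor_surjective hle)

theorem isOpen_J (k : Type u) (A : Type v) [Field k] [Ring A] [Algebra k A]
    [TopologicalSpace A] [IsTopologicalRing A] (h : FiniteDimensional k (A ⧸ J A)) :
    IsOpen (J A : Set A) := by
  have : IsArtinian A (A ⧸ J A) := isArtinian_of_tower k inferInstance
  let S : Set (Submodule A (A ⧸ J A)) :=
    {P | IsOpen ((P.comap (J A).mkQ : Submodule A A) : Set A)}
  obtain ⟨P, hP, hmin⟩ := IsArtinian.set_has_minimal S ⟨⊤, by simp [S]⟩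
  refine AddSubgroup.isOpen_mono (H₁ := (P.comap (J A).mkQ).toAddSubgroup)
    (H₂ := (J A).toAddSubgroup) ?_ hP
  change P.comap (J A).mkQ ≤ J A
  refine le_sInf ?_
  rintro M ⟨hMo, hM⟩
  have hJM : J A ≤ M := sInf_le ⟨hMo, hM⟩
  have hc : (M.map (J A).mkQ).comap (J A).mkQ = M := by
    rw [Submodule.comap_map_mkQ]; exact sup_eq_right.2 hJM
  have hmem : P ⊓ M.map (J A).mkQ ∈ S := by
    change IsOpen (((P.comap (J A).mkQ ⊓ (M.map (J A).mkQ).comap (J A).mkQ : Submodule A A)) : Set A)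
    rw [hc]
    exact IsOpen.inter hP hMo
  have hle : P ≤ M.map (J A).mkQ := by
    by_contra hn
    exact hmin _ hmem (lt_of_le_of_ne inf_le_left (fun e => hn (inf_eq_left.1 e)))
  rw [← hc]
  exact Submodule.comap_mono hle

/-- A continuous homomorphism to a pointed algebra maps the radical into the radical; this is what
makes the induced map of radical quotients meaningful. -/
theorem J_le_comap {k : Type u} {A B : Type v} [Field k] [Ring A] [Algebra k A]
    [TopologicalSpace A] [IsTopologicalRing A] [Ring B] [Algebra k B] [TopologicalSpace B]
    [IsTopologicalRing B] (hB : IsPointed k B) (hfin : FiniteDimensional k (B ⧸ J2 B))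
    (f : A →A[k] B) : J A ≤ (J B).comap (f : A →ₐ[k] B) := by
  have hJo := isOpen_J k B (finiteDimensional_quotient_J k B hfin)
  obtain ⟨ι, ⟨e⟩⟩ := hB
  intro a ha
  change f a ∈ J B
  rw [← Ideal.Quotient.eq_zero_iff_mem]
  apply e.injective
  rw [map_zero]
  funext i
  let g : A →ₐ[k] k := ((Pi.evalAlgHom k (fun _ : ι => k) i).comp e.toAlgHom).comp
    ((Ideal.Quotient.mkₐ k (J B)).comp (f : A →ₐ[k] B))
  have hg : Function.Surjective g := fun c => ⟨algebraMap k A c, by simp [g.commutes]⟩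
  have hmax : (RingHom.ker g).IsMaximal := RingHom.ker_isMaximal_of_surjective g hg
  have hopen : IsOpen (RingHom.ker g : Set A) := by
    refine AddSubgroup.isOpen_mono
      (H₁ := ((J B).comap (f : A →ₐ[k] B)).toAddSubgroup)
      (H₂ := (RingHom.ker g).toAddSubgroup) ?_ (hJo.preimage f.continuous)
    intro x hx
    have hx' : (Ideal.Quotient.mk (J B)) (f x) = 0 := Ideal.Quotient.eq_zero_iff_mem.2 hx
    change e (Ideal.Quotient.mk (J B) (f x)) i = 0
    rw [hx', map_zero]; rfl
  exact (sInf_le (a := RingHom.ker g) ⟨hopen, hmax⟩ : J A ≤ _) ha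

end Algebras

end PAlgebra

open PAlgebra

/-- Objects of the category `PAlg` over `k`: pointed pseudocompact `k`-algebras `A` such that
`A ⧸ J²(A)` has finite dimension. -/
structure PAlg (k : Type u) [Field k] where
  carrier : Type v
  [ring : Ring carrier]
  [algebra : Algebra k carrier]
  [topology : TopologicalSpace carrier]
  [topologicalRing : IsTopologicalRing carrier]
  pseudocompact : IsPseudocompact k carrier
  pointed : IsPointed k carrier
  finiteDimensional : FiniteDimensional k (carrier ⧸ J2 carrier)

namespace PAlg

attribute [instance] ring algebra topology topologicalRing

variable {k : Type u} [Field k]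

instance : CoeSort (PAlg.{u, v} k) (Type v) := ⟨PAlg.carrier⟩

/-- The map `A ⧸ J(A) → B ⧸ J(B)` induced by a continuous algebra homomorphism. -/
def inducedMap {A B : PAlg.{u, v} k} (f : A →A[k] B) : (A ⧸ J A) →ₐ[k] (B ⧸ J B) :=
  Ideal.quotientMapₐ (J B) (f : A →ₐ[k] B) (J_le_comap B.pointed B.finiteDimensional f)

/-- Morphisms of `PAlg`: continuous unital algebra homomorphisms whose induced map of radical
quotients is surjective. -/
@[ext]
structure Hom (A B : PAlg.{u, v} k) where
  toFun : A →A[k] B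
  surjective : Function.Surjective (inducedMap toFun)

instance : Category (PAlg.{u, v} k) where
  Hom := Hom
  id A := ⟨ContinuousAlgHom.id k A, by
    intro x
    obtain ⟨a, rfl⟩ := Ideal.Quotient.mk_surjective x
    exact ⟨Ideal.Quotient.mk _ a, rfl⟩⟩
  comp {A B C} f g := ⟨g.toFun.comp f.toFun, by
    have h := g.surjective.comp f.surjective
    intro x
    obtain ⟨y, hy⟩ := h x
    obtain ⟨a, rfl⟩ := Ideal.Quotient.mk_surjective y
    exact ⟨Ideal.Quotient.mk _ a, hy⟩⟩

/-- The relation `α ∼₁ β`: `(α - β)(A) ⊆ J(B)` and `(α - β)(J(A)) ⊆ J²(B)`. -/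
def simOne : HomRel (PAlg.{u, v} k) := fun A B α β =>
  (∀ a : A, α.toFun a - β.toFun a ∈ J B) ∧ (∀ a ∈ J A, α.toFun a - β.toFun a ∈ J2 B)

/-- `∼₁` is a congruence, so that the morphisms of the quotient category are exactly the
`∼₁`-classes of morphisms of `PAlg`. -/
instance simOne_congruence : Congruence (simOne : HomRel (PAlg.{u, v} k)) where
  equivalence := by
    intro A B
    refine ⟨fun f => ⟨fun a => by simp, fun a _ => by simp⟩,
      fun {f g} h => ⟨fun a => ?_, fun a ha => ?_⟩,
      fun {f g l} h h' => ⟨fun a => ?_, fun a ha => ?_⟩⟩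
    · simpa using (J B).neg_mem (h.1 a)
    · simpa using (J2 B).neg_mem (h.2 a ha)
    · simpa using (J B).add_mem (h.1 a) (h'.1 a)
    · simpa using (J2 B).add_mem (h.2 a ha) (h'.2 a ha)
  comp_left := by
    intro A B C f g g' h
    exact ⟨fun a => h.1 (f.toFun a), fun a ha =>
      h.2 _ (J_le_comap B.pointed B.finiteDimensional f.toFun ha)⟩
  comp_right := by
    intro A B C f f' g h
    have hJ := J_le_comap C.pointed C.finiteDimensional g.toFun
    refine ⟨fun a => ?_, fun a ha => ?_⟩
    · have := hJ (h.1 a)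
      change g.toFun (f.toFun a) - g.toFun (f'.toFun a) ∈ J C
      rw [← map_sub]
      exact this
    · have key : J2 B ≤ (J2 C).comap (g.toFun : B →ₐ[k] C) := by
        refine Ideal.mul_le.2 fun r hr s hs => ?_
        have h1 : g.toFun r ∈ J C := hJ hr
        have h2 : g.toFun s ∈ J C := hJ hs
        change g.toFun (r * s) ∈ J2 C
        rw [map_mul]
        exact Ideal.mul_mem_mul h1 h2
      have := key (h.2 a ha)
      change g.toFun (f.toFun a) - g.toFun (f'.toFun a) ∈ J2 C
      rw [← map_sub]
      exact this

end PAlg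

/-- The quotient category `PAlg₁ = PAlg / ∼₁`. -/
abbrev PAlgOne (k : Type u) [Field k] :=
  CategoryTheory.Quotient (PAlg.simOne (k := k) : HomRel (PAlg.{u, v} k))

/-- The projection functor `Π₁ : PAlg ⥤ PAlg₁`. -/
abbrev PAlg.projOne (k : Type u) [Field k] : PAlg.{u, v} k ⥤ PAlgOne.{u, v} k :=
  CategoryTheory.Quotient.functor _

/-! Put `δ = 1 - α`. The hypothesis says that `δ` maps `A` into `J` and `J` into `J²`;
multiplicativity of `α` propagates this to `δ(Jⁿ) ⊆ Jⁿ⁺¹` for all `n` (`map_sub_self_mem_J_pow`).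
Every basic open ideal contains some `Jⁿ`, because the radical of an Artinian quotient is nilpotent
(`OpenIdeal.exists_J_pow_le`). Hence the Neumann series `∑ δⁱ b` converges by completeness and
inverts `α`; modulo an open ideal it is a finite sum, so the inverse is continuous. For reflection,
lift the inverse class to `β`: both composites of `α` and `β` are `∼₁` to identities, hence
invertible, and so `α` is invertible. -/

namespace PAlgebra

/-! ### Open ideals and powers of the radical -/

section OpenIdeals

variable {k : Type u} {A : Type v} [Field k] [Ring A] [Algebra k A] [TopologicalSpace A]

/-- Every open two-sided ideal of finite codimension contains a power of the radical. -/
theorem OpenIdeal.exists_J_pow_le [IsTopologicalRing A] (I : OpenIdeal k A) :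
    ∃ n : ℕ, J A ^ n ≤ I.ideal := by
  have := I.isTwoSided
  have := I.finiteDimensional
  have : IsArtinianRing (A ⧸ I.ideal) := isArtinian_of_tower k inferInstance
  -- Maximal left ideals of the quotient pull back to maximal left ideals containing `I`, which are
  -- therefore open.
  have hJ : ∀ a ∈ J A, Ideal.Quotient.mk I.ideal a ∈ Ring.jacobson (A ⧸ I.ideal) := by
    intro a ha
    refine Submodule.mem_sInf.2 fun M hM => ?_
    have hM' : (Ideal.comap (Ideal.Quotient.mk I.ideal) M).IsMaximal :=
      have : Ideal.IsMaximal M := ⟨hM⟩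
      Ideal.comap_isMaximal_of_surjective _ Ideal.Quotient.mk_surjective
    refine Submodule.mem_sInf.1 ha _ ⟨?_, hM'⟩
    refine AddSubgroup.isOpen_mono (H₁ := I.ideal.toAddSubgroup)
      (H₂ := (Ideal.comap (Ideal.Quotient.mk I.ideal) M).toAddSubgroup) (fun x hx => ?_) I.isOpen
    change Ideal.Quotient.mk I.ideal x ∈ M
    rw [Ideal.Quotient.eq_zero_iff_mem.2 hx]
    exact M.zero_mem
  have hpow : ∀ n : ℕ, ∀ a ∈ J A ^ n,
      Ideal.Quotient.mk I.ideal a ∈ Ring.jacobson (A ⧸ I.ideal) ^ n := by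
    intro n
    induction n with
    | zero => intro a _; rw [Submodule.pow_zero, Ideal.one_eq_top]; trivial
    | succ n ih =>
      intro a ha
      rw [Submodule.pow_succ] at ha ⊢
      refine Submodule.mul_induction_on ha (fun x hx y hy => ?_) (fun x y hx hy => ?_)
      · rw [map_mul]
        exact Submodule.mul_mem_mul (ih x hx) (hJ y hy)
      · rw [map_add]
        exact add_mem hx hy
  obtain ⟨n, hn⟩ := IsSemiprimaryRing.isNilpotent (R := A ⧸ I.ideal)
  refine ⟨n, fun a ha => Ideal.Quotient.eq_zero_iff_mem.1 ?_⟩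
  have := hpow n a ha
  rw [hn] at this
  exact this

/-- Elements of a pseudocompact algebra that agree modulo every open ideal are equal. -/
theorem IsPseudocompact.eq_of_forall_sub_mem [IsTopologicalRing A] (hA : IsPseudocompact k A)
    {a b : A} (h : ∀ I : OpenIdeal k A, a - b ∈ I.ideal) : a = b := by
  have := hA.t2Space
  by_contra hab
  obtain ⟨I, -, hI⟩ := hA.hasBasis.mem_iff.1
    (isOpen_compl_singleton.mem_nhds (fun e : (0 : A) = a - b => hab (sub_eq_zero.1 e.symm)))
  exact hI (h I) rfl

end OpenIdeals

/-! ### Inverting an endomorphism by its Neumann series -/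

section Unipotent

variable {k : Type u} {A : Type v} [Field k] [Ring A] [Algebra k A] [TopologicalSpace A]

/-- An endomorphism congruent to the identity on `A ⧸ J` and on `J ⧸ J²` is congruent to the
identity on every `Jⁿ ⧸ Jⁿ⁺¹`. -/
theorem map_sub_self_mem_J_pow (α : A →A[k] A) (h0 : ∀ a, α a - a ∈ J A)
    (h1 : ∀ a ∈ J A, α a - a ∈ J2 A) (n : ℕ) : ∀ a ∈ J A ^ n, α a - a ∈ J A ^ (n + 1) := by
  induction n with
  | zero => intro a _; rw [zero_add, Submodule.pow_one]; exact h0 a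
  | succ n ih =>
    intro a ha
    rw [Submodule.pow_succ] at ha
    refine Submodule.mul_induction_on ha (fun x hx y hy => ?_) (fun x y hx hy => ?_)
    · have hy2 := h1 y hy
      have hαy : α y ∈ J A := by
        have : J2 A ≤ J A := Ideal.mul_le_right
        simpa using add_mem (this hy2) hy
      -- Twisted Leibniz rule: the two terms lie in `Jⁿ⁺¹ J` and `Jⁿ J²`.
      have e : α (x * y) - x * y = (α x - x) * α y + x * (α y - y) := by
        rw [map_mul]; noncomm_ring
      rw [e]
      refine add_mem ?_ ?_
      · rw [Submodule.pow_succ]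
        exact Submodule.mul_mem_mul (ih x hx) hαy
      · rw [Submodule.pow_succ, Submodule.pow_succ, mul_assoc]
        exact Submodule.mul_mem_mul hx hy2
    · have e : α (x + y) - (x + y) = (α x - x) + (α y - y) := by
        rw [map_add]; abel
      rw [e]
      exact add_mem hx hy

/-- The partial sums `∑_{i < n} (1 - α)ⁱ b` of the Neumann series of the inverse of `α`. -/
def neumannSum (α : A →A[k] A) : ℕ → A → A
  | 0, _ => 0
  | n + 1, b => neumannSum α n b + (b - α (neumannSum α n b))

theorem neumannSum_zero_right (α : A →A[k] A) (n : ℕ) : neumannSum α n 0 = 0 := by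
  induction n with
  | zero => rfl
  | succ n ih => simp [neumannSum, ih]

theorem continuous_neumannSum [IsTopologicalRing A] (α : A →A[k] A) (n : ℕ) :
    Continuous (neumannSum α n) := by
  induction n with
  | zero => exact continuous_const
  | succ n ih => exact ih.add (continuous_id.sub (α.continuous.comp ih))

variable {α : A →A[k] A}

/-- The residual `r = b - α s` of a partial sum becomes `r - α r` at the next stage, so each stage
gains one power of `J`. -/
theorem sub_map_neumannSum_mem (hα : ∀ n : ℕ, ∀ a ∈ J A ^ n, α a - a ∈ J A ^ (n + 1))
    (n : ℕ) (b : A) : b - α (neumannSum α n b) ∈ J A ^ n := by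
  induction n with
  | zero => rw [Submodule.pow_zero, Ideal.one_eq_top]; trivial
  | succ n ih =>
    have h := neg_mem (hα n _ ih)
    rw [neg_sub] at h
    have e : b - α (neumannSum α (n + 1) b)
        = (b - α (neumannSum α n b)) - α (b - α (neumannSum α n b)) := by
      rw [neumannSum, map_add]; abel
    rwa [e]

theorem neumannSum_sub_mem (hα : ∀ n : ℕ, ∀ a ∈ J A ^ n, α a - a ∈ J A ^ (n + 1))
    {n m : ℕ} (h : n ≤ m) (b : A) : neumannSum α m b - neumannSum α n b ∈ J A ^ n := by
  induction m, h using Nat.le_induction with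
  | base => simp
  | succ m hm ih =>
    have h1 := Ideal.pow_le_pow_right hm (sub_map_neumannSum_mem hα m b)
    have e : neumannSum α (m + 1) b - neumannSum α n b
        = (neumannSum α m b - neumannSum α n b) + (b - α (neumannSum α m b)) := by
      rw [neumannSum]; abel
    rw [e]
    exact add_mem ih h1

/-- Exponents chosen independently for different open ideals need not be ordered; this makes the
choice irrelevant modulo `I`. -/
theorem neumannSum_sub_mem_of_le (hα : ∀ n : ℕ, ∀ a ∈ J A ^ n, α a - a ∈ J A ^ (n + 1))
    {I : Ideal A} {n m : ℕ} (hn : J A ^ n ≤ I) (hm : J A ^ m ≤ I) (b : A) :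
    neumannSum α m b - neumannSum α n b ∈ I := by
  rcases le_total n m with h | h
  · exact hn (neumannSum_sub_mem hα h b)
  · simpa using neg_mem (hm (neumannSum_sub_mem hα h b))

theorem exists_sub_neumannSum_mem [IsTopologicalRing A] (hA : IsPseudocompact k A)
    (hα : ∀ n : ℕ, ∀ a ∈ J A ^ n, α a - a ∈ J A ^ (n + 1)) (b : A) :
    ∃ a : A, ∀ (I : OpenIdeal k A) (n : ℕ), J A ^ n ≤ I.ideal →
      a - neumannSum α n b ∈ I.ideal := by
  choose N hN using fun I : OpenIdeal k A => I.exists_J_pow_le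
  obtain ⟨a, ha⟩ := hA.complete (fun I => Submodule.Quotient.mk (neumannSum α (N I) b)) (by
    intro I I' h
    exact (Submodule.Quotient.eq _).2
      (neumannSum_sub_mem_of_le hα (hN I') ((hN I).trans h) b))
  refine ⟨a, fun I n hn => ?_⟩
  simpa using add_mem ((Submodule.Quotient.eq _).1 (ha I))
    (neumannSum_sub_mem_of_le hα hn (hN I) b)

theorem map_eq_of_sub_neumannSum_mem [IsTopologicalRing A] (hA : IsPseudocompact k A)
    (hα : ∀ n : ℕ, ∀ a ∈ J A ^ n, α a - a ∈ J A ^ (n + 1)) {a b : A}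
    (h : ∀ (I : OpenIdeal k A) (n : ℕ), J A ^ n ≤ I.ideal → a - neumannSum α n b ∈ I.ideal) :
    α a = b := by
  refine hA.eq_of_forall_sub_mem fun I => ?_
  -- The limit `a` is approximated only modulo basic open ideals, so one is chosen inside `α⁻¹(I)`.
  -- The larger exponent then controls both `α` of the error and the residual.
  have hI : (α : A → A) ⁻¹' (I.ideal : Set A) ∈ 𝓝 (0 : A) :=
    (I.isOpen.preimage α.continuous).mem_nhds (by simp)
  obtain ⟨I', -, hI'⟩ := hA.hasBasis.mem_iff.1 hI
  obtain ⟨n, hn⟩ := I.exists_J_pow_le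
  obtain ⟨n', hn'⟩ := I'.exists_J_pow_le
  have h1 : α (a - neumannSum α (max n n') b) ∈ I.ideal :=
    hI' (h I' _ ((Ideal.pow_le_pow_right (le_max_right n n')).trans hn'))
  have h2 := hn (Ideal.pow_le_pow_right (le_max_left n n')
    (sub_map_neumannSum_mem hα (max n n') b))
  have e : α a - b = α (a - neumannSum α (max n n') b) - (b - α (neumannSum α (max n n') b)) := by
    rw [map_sub]; abel
  rw [e]
  exact sub_mem h1 h2

/-- If `α a = 0`, then `a = -(α a - a)` climbs through all powers of `J`, hence lies in every open
ideal. -/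
theorem injective_of_map_sub_self_mem [IsTopologicalRing A] (hA : IsPseudocompact k A)
    (hα : ∀ n : ℕ, ∀ a ∈ J A ^ n, α a - a ∈ J A ^ (n + 1)) : Function.Injective α := by
  refine (injective_iff_map_eq_zero α).2 fun a ha => ?_
  have hmem : ∀ n : ℕ, a ∈ J A ^ n := by
    intro n
    induction n with
    | zero => rw [Submodule.pow_zero, Ideal.one_eq_top]; trivial
    | succ n ih => simpa [ha] using hα n a ih
  refine hA.eq_of_forall_sub_mem fun I => ?_
  obtain ⟨n, hn⟩ := I.exists_J_pow_le
  simpa using hn (hmem n)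

/-- An endomorphism of a pseudocompact algebra inducing the identity on every `Jⁿ ⧸ Jⁿ⁺¹` has a
continuous inverse. -/
theorem exists_continuous_inverse [IsTopologicalRing A] (hA : IsPseudocompact k A)
    (hα : ∀ n : ℕ, ∀ a ∈ J A ^ n, α a - a ∈ J A ^ (n + 1)) :
    ∃ β : A →A[k] A, (∀ a, β (α a) = a) ∧ ∀ b, α (β b) = b := by
  have hinj := injective_of_map_sub_self_mem hA hα
  have hsurj : Function.Surjective α := fun b => by
    obtain ⟨a, ha⟩ := exists_sub_neumannSum_mem hA hα b
    exact ⟨a, map_eq_of_sub_neumannSum_mem hA hα ha⟩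
  let e : A ≃ₐ[k] A := AlgEquiv.ofBijective (α : A →ₐ[k] A) ⟨hinj, hsurj⟩
  have hαe : ∀ b, α (e.symm b) = b := fun b => e.apply_symm_apply b
  have hlim : ∀ (b : A) (I : OpenIdeal k A) (n : ℕ), J A ^ n ≤ I.ideal →
      e.symm b - neumannSum α n b ∈ I.ideal := by
    intro b
    obtain ⟨a, ha⟩ := exists_sub_neumannSum_mem hA hα b
    have : e.symm b = a := hinj ((hαe b).trans (map_eq_of_sub_neumannSum_mem hA hα ha).symm)
    rwa [this]
  have hcont : Continuous e.symm := by
    refine continuous_of_continuousAt_zero e.symm ?_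
    rw [ContinuousAt, map_zero, hA.hasBasis.tendsto_right_iff]
    intro I _
    obtain ⟨n, hn⟩ := I.exists_J_pow_le
    -- Modulo `I` the inverse agrees with a fixed continuous partial sum; `Jⁿ` itself is not needed
    -- to be open.
    have hopen : neumannSum α n ⁻¹' (I.ideal : Set A) ∈ 𝓝 (0 : A) :=
      (I.isOpen.preimage (continuous_neumannSum α n)).mem_nhds
        (by simp [neumannSum_zero_right])
    filter_upwards [hopen] with b hb
    simpa using add_mem (hlim b I n hn) hb
  exact ⟨⟨e.symm, hcont⟩, fun a => e.symm_apply_apply a, hαe⟩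

end Unipotent

end PAlgebra

/-! ### Isomorphisms in `PAlg` and its quotient -/

namespace PAlg

variable {k : Type u} [Field k]

/-- An endomorphism `α` with `α ∼₁ 𝟙` is an isomorphism. -/
theorem isIso_of_simOne_id {A : PAlg.{u, v} k} (α : A ⟶ A) (h : simOne α (𝟙 A)) : IsIso α := by
  have h0 : ∀ a : A, α.toFun a - a ∈ J A := h.1
  obtain ⟨β, hβα, hαβ⟩ := exists_continuous_inverse A.pseudocompact
    (map_sub_self_mem_J_pow α.toFun h0 h.2)
  have hβ : Function.Surjective (inducedMap β) := by
    intro x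
    obtain ⟨a, rfl⟩ := Ideal.Quotient.mk_surjective x
    refine ⟨Ideal.Quotient.mk _ a, Ideal.Quotient.eq.2 ?_⟩
    change β a - a ∈ J A
    -- Applying `α ≡ 1` modulo `J` at `β a` shows that `β` also induces the identity on `A ⧸ J`.
    have := neg_mem (h0 (β a))
    rwa [hαβ, neg_sub] at this
  refine ⟨⟨(⟨β, hβ⟩ : Hom A A), Hom.ext ?_, Hom.ext ?_⟩⟩
  · exact ContinuousAlgHom.ext hβα
  · exact ContinuousAlgHom.ext hαβ

theorem isIso_of_isIso_projOne_map {A B : PAlg.{u, v} k} (α : A ⟶ B)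
    (h : IsIso ((projOne k).map α)) : IsIso α := by
  obtain ⟨β, hβ⟩ := (projOne k).map_surjective (inv ((projOne k).map α))
  have h1 : simOne (α ≫ β) (𝟙 A) := by
    -- As `∼₁` is a congruence, equality of classes is `∼₁` itself, not merely a relation it
    -- generates.
    refine (CategoryTheory.Quotient.functor_map_eq_iff simOne _ _).1 ?_
    change (projOne k).map (α ≫ β) = (projOne k).map (𝟙 A)
    rw [Functor.map_comp, hβ, IsIso.hom_inv_id, CategoryTheory.Functor.map_id]
  have h2 : simOne (β ≫ α) (𝟙 B) := by
    refine (CategoryTheory.Quotient.functor_map_eq_iff simOne _ _).1 ?_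
    change (projOne k).map (β ≫ α) = (projOne k).map (𝟙 B)
    rw [Functor.map_comp, hβ, IsIso.inv_hom_id, CategoryTheory.Functor.map_id]
  have := isIso_of_simOne_id _ h1
  have := isIso_of_simOne_id _ h2
  have : IsSplitMono α := ⟨⟨⟨β ≫ inv (α ≫ β), by rw [← Category.assoc, IsIso.hom_inv_id]⟩⟩⟩
  have : Epi α := epi_of_epi β α
  exact isIso_of_epi_of_isSplitMono α

end PAlg

theorem mainTheorem8 (k : Type u) [Field k] [PerfectField k] :
    (∀ (A : PAlg.{u, v} k) (α : A ⟶ A), PAlg.simOne α (𝟙 A) → IsIso α) ∧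
      (PAlg.projOne.{u, v} k).ReflectsIsomorphisms :=
  ⟨fun _ α h => PAlg.isIso_of_simOne_id α h,
    ⟨fun α h => PAlg.isIso_of_isIso_projOne_map α h⟩⟩
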